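/- Let $G$ be a group. An equipment of $G$ is a subset $O\subseteq G$ with $1\notin O$ that is invariant under conjugation and is the union of finitely many conjugacy classes $O=C_1\sqcup\dots\sqcup C_m$ of $G$. Let $S(G,O)$ be the factorization semigroup (with unit), generated by letters $x_g$, $g\in O$, subject to the relations $$x_{g_1}\cdot x_{g_2}=x_{g_2}\cdot x_{g_2^{-1}g_1g_2}=x_{g_1g_2g_1^{-1}}\cdot x_{g_1}\qquad(g_1,g_2\in O).$$ For $s=x_{g_1}\cdots x_{g_n}\in S(G,O)$ let $\alpha_G(s)=g_1\cdots g_n\in G$ be its product, let $\tau(s)=(\tau_1(s),\dots,\tau_m(s))\in\mathbb Z_{\ge 0}^m$ be its type, where $\tau_i(s)$ is the number of indices $j$ with $g_j\in C_i$, and let $G_s=\langle g_1,\dots,g_n\rangle$; none of these depends on the chosen word. Put $S(G,O)^G=\{s\in S(G,O)\mid G_s=G\}$. Let $G_{\Gamma_{(G,O)}}$ be the group with generators $y_g$, $g\in O$, and relations $y_g^{-1}y_{g_1}y_g=y_{g_2}$ for all $g,g_1,g_2\in O$ with $g^{-1}g_1g=g_2$, and let $\beta_{(G,O)}:G_{\Gamma_{(G,O)}}\to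 G$ be the homomorphism $y_g\mapsto g$. If $O$ generates $G$, the ambiguity index of $(G,O)$ is the order $$a_{(G,O)}=\bigl|\ker\beta_{(G,O)}\cap[G_{\Gamma_{(G,O)}},G_{\Gamma_{(G,O)}}]\bigr|.$$ **Theorem.** Let $G$ be a finite group with equipments $O'\subseteq O$, where $O=C_1\sqcup\dots\sqcup C_m$ and $O'=C_1\sqcup\dots\sqcup C_k$, $k\le m$, and suppose that the elements of $O'$ generate $G$. Then there is a constant $T=T_{(O,O')}\in\mathbb N$ such that for every $s_1\in S(G,O)^G$ with $\tau_i(s_1)\ge T$ for all $i=1,\dots,k$, there are at most $a_{(G,O')}$ distinct elements $s\in S(G,O)^G$ (counting $s_1$ itself) with $\tau(s)=\tau(s_1)$ and $\alpha_G(s)=\alpha_G(s_1)$. -/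

import Mathlib

/-- An equipment of a group `G`: a subset `O` of `G`, invariant under inner automorphisms, that does
not contain the identity. (For a finite group `G` it automatically consists of a finite number of
conjugacy classes.) -/
@[ext]
structure Equipment (G : Type*) [Group G] where
  /-- the underlying subset `O` of `G` -/
  carrier : Set G
  conj_mem : ∀ g ∈ carrier, ∀ h : G, h * g * h⁻¹ ∈ carrier
  one_notMem : (1 : G) ∉ carrier

namespace Equipment

variable {G : Type*} [Group G]

theorem inv_conj_mem (O : Equipment G) {g : G} (hg : g ∈ O.carrier) (h : G) :
    h⁻¹ * g * h ∈ O.carrier := by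
  simpa using O.conj_mem g hg h⁻¹

/-- The defining relations of the factorization semigroup:
`x_{g₁} x_{g₂} = x_{g₂} x_{g₂⁻¹ g₁ g₂}` and `x_{g₁} x_{g₂} = x_{g₁ g₂ g₁⁻¹} x_{g₁}`,
for all `g₁, g₂ ∈ O`. -/
inductive FactRel (O : Equipment G) : FreeMonoid O.carrier → FreeMonoid O.carrier → Prop
  | right (g₁ g₂ : O.carrier) :
      FactRel O (FreeMonoid.of g₁ * FreeMonoid.of g₂)
        (FreeMonoid.of g₂ *
          FreeMonoid.of ⟨(g₂ : G)⁻¹ * (g₁ : G) * (g₂ : G), O.inv_conj_mem g₁.2 g₂⟩)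
  | left (g₁ g₂ : O.carrier) :
      FactRel O (FreeMonoid.of g₁ * FreeMonoid.of g₂)
        (FreeMonoid.of ⟨(g₁ : G) * (g₂ : G) * (g₁ : G)⁻¹, O.conj_mem g₂ g₂.2 g₁⟩ *
          FreeMonoid.of g₁)

/-- The factorization semigroup `S(G, O)`, generated by the letters `x_g`, `g ∈ O`, subject to the
relations `FactRel` (with the empty product as a unit). -/
abbrev FactSemigroup (O : Equipment G) : Type _ := PresentedMonoid O.FactRel

/-- The generator `x_g` of `S(G, O)`. -/
def x (O : Equipment G) (g : O.carrier) : O.FactSemigroup := PresentedMonoid.of O.FactRel g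

/-- The product homomorphism `α : S(G, O) → G`, `x_g ↦ g`. -/
def prodHom (O : Equipment G) : O.FactSemigroup →* G :=
  PresentedMonoid.lift (fun g : O.carrier => (g : G)) (by
    rintro _ _ (⟨g₁, g₂⟩ | ⟨g₁, g₂⟩) <;> simp [mul_assoc])

/-- The set of conjugacy classes of `G` of which `O` consists. -/
abbrev Classes (O : Equipment G) : Type _ := {c : ConjClasses G // c.carrier ⊆ O.carrier}

/-- The conjugacy class of an element of `O`. -/
def classOf (O : Equipment G) (g : O.carrier) : O.Classes :=
  ⟨ConjClasses.mk (g : G), by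
    intro h hh
    obtain ⟨c, rfl⟩ := isConj_iff.1 (ConjClasses.mk_eq_mk_iff_isConj.1
      (ConjClasses.mem_carrier_iff_mk_eq.1 hh).symm)
    exact O.conj_mem g g.2 c⟩

theorem classOf_eq (O : Equipment G) {g h : O.carrier} (c : G)
    (hc : c * (g : G) * c⁻¹ = h) : O.classOf g = O.classOf h :=
  Subtype.ext (ConjClasses.mk_eq_mk_iff_isConj.2 (isConj_iff.2 ⟨c, hc⟩))

open Classical in
/-- The type homomorphism `τ`, into the additive monoid of functions from the conjugacy classes in
`O` to `ℕ`: the letter `x_g` goes to the basis vector of the conjugacy class of `g`. -/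
noncomputable def typeHom (O : Equipment G) :
    O.FactSemigroup →* Multiplicative (O.Classes → ℕ) :=
  PresentedMonoid.lift (fun g : O.carrier => Multiplicative.ofAdd (Pi.single (O.classOf g) 1)) (by
    rintro _ _ (⟨g₁, g₂⟩ | ⟨g₁, g₂⟩)
    · have h := O.classOf_eq (g := ⟨(g₂ : G)⁻¹ * (g₁ : G) * (g₂ : G), O.inv_conj_mem g₁.2 g₂⟩)
        (h := g₁) (g₂ : G) (by simp [mul_assoc])
      simp only [map_mul, FreeMonoid.lift_eval_of]
      rw [h, mul_comm]
    · have h := O.classOf_eq (h := ⟨(g₁ : G) * (g₂ : G) * (g₁ : G)⁻¹, O.conj_mem g₂ g₂.2 g₁⟩)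
        (g := g₂) (g₁ : G) rfl
      simp only [map_mul, FreeMonoid.lift_eval_of]
      rw [← h, mul_comm])

/-- The type of `s ∈ S(G, O)`: the coordinate `s.type c` is the number of factors of `s` that lie in
the conjugacy class `c ⊆ O`. -/
noncomputable def type (O : Equipment G) (s : O.FactSemigroup) : O.Classes → ℕ :=
  Multiplicative.toAdd (O.typeHom s)

/-- The subgroup of `G` generated by the letters of a word. -/
def wordSubgroup (O : Equipment G) (w : FreeMonoid O.carrier) : Subgroup G :=
  Subgroup.closure {g : G | ∃ a ∈ FreeMonoid.toList w, (a : G) = g}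

theorem wordSubgroup_mul (O : Equipment G) (v w : FreeMonoid O.carrier) :
    O.wordSubgroup (v * w) = O.wordSubgroup v ⊔ O.wordSubgroup w := by
  rw [wordSubgroup, wordSubgroup, wordSubgroup, ← Subgroup.closure_union]
  congr 1
  ext g
  simp only [FreeMonoid.toList_mul, List.mem_append, Set.mem_ofPred_eq, Set.mem_union]
  constructor
  · rintro ⟨a, h | h, rfl⟩
    · exact Or.inl ⟨a, h, rfl⟩
    · exact Or.inr ⟨a, h, rfl⟩
  · rintro (⟨a, h, rfl⟩ | ⟨a, h, rfl⟩)
    · exact ⟨a, Or.inl h, rfl⟩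
    · exact ⟨a, Or.inr h, rfl⟩

theorem wordSubgroup_of (O : Equipment G) (g : O.carrier) :
    O.wordSubgroup (FreeMonoid.of g) = Subgroup.closure {(g : G)} := by
  rw [wordSubgroup]
  congr 1
  ext h
  simp [eq_comm]

/-- The subgroup generated by the letters does not depend on the choice of the word. -/
theorem wordSubgroup_eq (O : Equipment G) (v w : FreeMonoid O.carrier)
    (h : conGen O.FactRel v w) : O.wordSubgroup v = O.wordSubgroup w := by
  let c : Con (FreeMonoid O.carrier) :=
    { r := fun v w => O.wordSubgroup v = O.wordSubgroup w
      iseqv := ⟨fun _ => rfl, Eq.symm, Eq.trans⟩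
      mul' := fun h₁ h₂ => by rw [wordSubgroup_mul, wordSubgroup_mul, h₁, h₂] }
  have hc : conGen O.FactRel ≤ c := by
    rw [Con.conGen_le]
    rintro _ _ (⟨g₁, g₂⟩ | ⟨g₁, g₂⟩)
    all_goals
      change O.wordSubgroup _ = O.wordSubgroup _
      simp only [wordSubgroup_mul, wordSubgroup_of]
      apply le_antisymm
    · refine sup_le ?_ le_sup_left
      rw [Subgroup.closure_le, Set.singleton_subset_iff]
      have h₂ : (g₂ : G) ∈ Subgroup.closure {(g₂ : G)} ⊔
          Subgroup.closure {(g₂ : G)⁻¹ * (g₁ : G) * (g₂ : G)} :=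
        le_sup_left (a := Subgroup.closure {(g₂ : G)})
          (Subgroup.subset_closure (Set.mem_singleton _))
      have h₃ : (g₂ : G)⁻¹ * (g₁ : G) * (g₂ : G) ∈ Subgroup.closure {(g₂ : G)} ⊔
          Subgroup.closure {(g₂ : G)⁻¹ * (g₁ : G) * (g₂ : G)} :=
        le_sup_right (a := Subgroup.closure {(g₂ : G)})
          (Subgroup.subset_closure (Set.mem_singleton _))
      simpa [mul_assoc] using mul_mem (mul_mem h₂ h₃) (inv_mem h₂)
    · refine sup_le le_sup_right ?_
      rw [Subgroup.closure_le, Set.singleton_subset_iff]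
      have h₁ : (g₁ : G) ∈ Subgroup.closure {(g₁ : G)} ⊔ Subgroup.closure {(g₂ : G)} :=
        le_sup_left (a := Subgroup.closure {(g₁ : G)})
          (Subgroup.subset_closure (Set.mem_singleton _))
      have h₂ : (g₂ : G) ∈ Subgroup.closure {(g₁ : G)} ⊔ Subgroup.closure {(g₂ : G)} :=
        le_sup_right (a := Subgroup.closure {(g₁ : G)})
          (Subgroup.subset_closure (Set.mem_singleton _))
      exact mul_mem (mul_mem (inv_mem h₂) h₁) h₂
    · refine sup_le le_sup_right ?_
      rw [Subgroup.closure_le, Set.singleton_subset_iff]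
      have h₁ : (g₁ : G) ∈ Subgroup.closure {(g₁ : G) * (g₂ : G) * (g₁ : G)⁻¹} ⊔
          Subgroup.closure {(g₁ : G)} :=
        le_sup_right (a := Subgroup.closure {(g₁ : G) * (g₂ : G) * (g₁ : G)⁻¹})
          (Subgroup.subset_closure (Set.mem_singleton _))
      have h₃ : (g₁ : G) * (g₂ : G) * (g₁ : G)⁻¹ ∈
          Subgroup.closure {(g₁ : G) * (g₂ : G) * (g₁ : G)⁻¹} ⊔ Subgroup.closure {(g₁ : G)} :=
        le_sup_left (a := Subgroup.closure {(g₁ : G) * (g₂ : G) * (g₁ : G)⁻¹})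
          (Subgroup.subset_closure (Set.mem_singleton _))
      simpa [mul_assoc] using mul_mem (mul_mem (inv_mem h₁) h₃) h₁
    · refine sup_le ?_ le_sup_left
      rw [Subgroup.closure_le, Set.singleton_subset_iff]
      have h₁ : (g₁ : G) ∈ Subgroup.closure {(g₁ : G)} ⊔ Subgroup.closure {(g₂ : G)} :=
        le_sup_left (a := Subgroup.closure {(g₁ : G)})
          (Subgroup.subset_closure (Set.mem_singleton _))
      have h₂ : (g₂ : G) ∈ Subgroup.closure {(g₁ : G)} ⊔ Subgroup.closure {(g₂ : G)} :=
        le_sup_right (a := Subgroup.closure {(g₁ : G)})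
          (Subgroup.subset_closure (Set.mem_singleton _))
      exact mul_mem (mul_mem h₁ h₂) (inv_mem h₁)
  exact hc h

/-- The subgroup `G_s` of `G` generated by the factors of `s ∈ S(G, O)`. -/
def factorSubgroup (O : Equipment G) (s : O.FactSemigroup) : Subgroup G :=
  Con.liftOn (c := conGen O.FactRel) s O.wordSubgroup O.wordSubgroup_eq

theorem factorSubgroup_mk (O : Equipment G) (w : FreeMonoid O.carrier) :
    O.factorSubgroup (PresentedMonoid.mk O.FactRel w) = O.wordSubgroup w := rfl

/-- The set `S(G, O)^G` of those `s ∈ S(G, O)` whose factors generate `G`. -/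
def fullElements (O : Equipment G) : Set O.FactSemigroup := {s | O.factorSubgroup s = ⊤}

/-- The defining relations of the `C`-group of the equipped group `(G, O)`: one relation
`y_g⁻¹ y_{g₁} y_g = y_{g₂}` for each edge of the `C`-graph of `(G, O)`, that is, for each triple of
elements of `O` with `g⁻¹ g₁ g = g₂` in `G` (tail `g₁`, head `g₂`, label `g`). -/
def cRels (O : Equipment G) : Set (FreeGroup O.carrier) :=
  {r | ∃ g₁ g₂ g : O.carrier, (g : G)⁻¹ * (g₁ : G) * (g : G) = (g₂ : G) ∧
    r = (FreeGroup.of g)⁻¹ * FreeGroup.of g₁ * FreeGroup.of g * (FreeGroup.of g₂)⁻¹}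

/-- The `C`-group of the equipped group `(G, O)`, with the `C`-generators `y_g`, `g ∈ O`. -/
abbrev CGroup (O : Equipment G) : Type _ := PresentedGroup O.cRels

/-- The natural homomorphism `β` from the `C`-group of `(G, O)` to `G`, `y_g ↦ g`. -/
def beta (O : Equipment G) : O.CGroup →* G :=
  PresentedGroup.toGroup (rels := O.cRels) (f := fun g : O.carrier => (g : G)) (by
    rintro _ ⟨g₁, g₂, g, h, rfl⟩
    simp [h])

/-- The ambiguity index `a_{(G, O)}`: the order of the intersection of the kernel of `β` with the
commutator subgroup of the `C`-group. -/
noncomputable def ambiguityIndex (O : Equipment G) : ℕ :=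
  Nat.card (O.beta.ker ⊓ commutator O.CGroup : Subgroup O.CGroup)

end Equipment

/-! Let `U` (`totalPow`) be the product of `x_g ^ |G|` over all `g ∈ O'`. Its product in `G` is `1`,
so it is central, and every letter of `O'` divides it.

Extraction: in `s · t` with `t` full, the factor `x_g ^ |G|` depends only on the class of `g`
(`centralPow_mul_eq`). With the pigeonhole principle, a full element with many letters in every
class of `O'` is `U ^ M * t` (`exists_inclHom_totalPow_pow_mul`). Exchange: if `t` and `t₁` have the
same type, then `U ^ M * t = u * t₁` with `u` full over `O'` and of the type of `U ^ M`
(`exists_inclHom_mul`). Equal products in `G` force `u` to have product `1`, so it suffices to count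
such `u`.

Counting: multiplication by `U` maps each sufficiently large stratum onto the next, so for an `M` of
minimal cardinality all further multiplications by `U` are injective
(`exists_injOn_totalPow_pow_mul`). Inverting `U` inverts every letter, so equality in the `C`-group
means equality after multiplication by some `U ^ k` (`exists_totalPow_pow_mul_eq`). Hence `u ↦ [u][U
^ M]⁻¹` embeds the remaining `u` into `ker β ∩ [ , ]`. -/

namespace Equipment

variable {G : Type*} [Group G]

/-! ### Generators and conjugation -/

/-- The action of `G` by conjugation on the letters. -/
def conjLetter (O : Equipment G) (a : G) (g : O.carrier) : O.carrier :=
  ⟨a * g * a⁻¹, O.conj_mem g g.2 a⟩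

@[simp]
theorem coe_conjLetter (O : Equipment G) (a : G) (g : O.carrier) :
    (O.conjLetter a g : G) = a * g * a⁻¹ := rfl

theorem conjLetter_mul (O : Equipment G) (a b : G) (g : O.carrier) :
    O.conjLetter (a * b) g = O.conjLetter a (O.conjLetter b g) := by
  ext; simp [mul_assoc]

theorem conjLetter_one (O : Equipment G) (g : O.carrier) : O.conjLetter 1 g = g := by
  ext; simp

theorem conjLetter_inv_self (O : Equipment G) (a : G) (g : O.carrier) :
    O.conjLetter a (O.conjLetter a⁻¹ g) = g := by
  ext; simp [mul_assoc]

theorem classOf_conjLetter (O : Equipment G) (a : G) (g : O.carrier) :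
    O.classOf (O.conjLetter a g) = O.classOf g :=
  (O.classOf_eq a rfl).symm

theorem exists_conjLetter_of_classOf_eq (O : Equipment G) {g h : O.carrier}
    (e : O.classOf g = O.classOf h) : ∃ a : G, O.conjLetter a g = h := by
  obtain ⟨a, ha⟩ := isConj_iff.1 (ConjClasses.mk_eq_mk_iff_isConj.1 (congrArg Subtype.val e))
  exact ⟨a, Subtype.ext ha⟩

theorem x_mul_x (O : Equipment G) (g h : O.carrier) :
    O.x g * O.x h = O.x (O.conjLetter (g : G) h) * O.x g :=
  PresentedMonoid.mk_eq_mk_of_rel (FactRel.left g h)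

@[elab_as_elim]
theorem factSemigroup_induction {O : Equipment G} {P : O.FactSemigroup → Prop} (one : P 1)
    (mul : ∀ g s, P s → P (O.x g * s)) (s : O.FactSemigroup) : P s := by
  obtain ⟨w, rfl⟩ := PresentedMonoid.surjective_mk s
  induction w using FreeMonoid.inductionOn' with
  | one => exact one
  | of_mul g w ih => exact mul g _ ih

@[elab_as_elim]
theorem factSemigroup_induction_right {O : Equipment G} {P : O.FactSemigroup → Prop} (one : P 1)
    (mul : ∀ g s, P s → P (s * O.x g)) (s : O.FactSemigroup) : P s := by
  obtain ⟨w, rfl⟩ := PresentedMonoid.surjective_mk s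
  change P (PresentedMonoid.mk O.FactRel (FreeMonoid.ofList w.toList))
  induction w.toList using List.reverseRecOn with
  | nil => exact one
  | append_singleton l g ih =>
    rw [FreeMonoid.ofList_append, map_mul]
    exact mul g _ ih

@[simp]
theorem prodHom_x (O : Equipment G) (g : O.carrier) : O.prodHom (O.x g) = g := rfl

/-- Iterates the defining relation; in particular an element with trivial product in `G` is central.
-/
theorem mul_x (O : Equipment G) (s : O.FactSemigroup) (h : O.carrier) :
    s * O.x h = O.x (O.conjLetter (O.prodHom s) h) * s := by
  induction s using factSemigroup_induction with
  | one => simp [conjLetter_one]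
  | mul g s ih =>
    rw [mul_assoc, ih, ← mul_assoc, x_mul_x, mul_assoc, map_mul, conjLetter_mul, prodHom_x]

theorem exists_x_mul_eq (O : Equipment G) (g : O.carrier) (s : O.FactSemigroup) :
    ∃ t, O.x g * s = t * O.x g := by
  induction s using factSemigroup_induction_right with
  | one => exact ⟨1, by simp⟩
  | mul h s ih =>
    obtain ⟨t, ht⟩ := ih
    exact ⟨t * O.x (O.conjLetter (g : G) h), by
      rw [← mul_assoc, ht, mul_assoc, x_mul_x, mul_assoc]⟩

theorem exists_x_mul_pow_eq (O : Equipment G) (g h : O.carrier) (n : ℕ) :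
    ∃ t, O.x h * O.x g ^ n = O.x g ^ n * t := by
  refine ⟨O.x (O.conjLetter (O.prodHom (O.x g ^ n))⁻¹ h), ?_⟩
  rw [mul_x, conjLetter_inv_self]

theorem commute_of_prodHom_eq_one (O : Equipment G) {s : O.FactSemigroup}
    (hs : O.prodHom s = 1) (t : O.FactSemigroup) : Commute s t := by
  induction t using factSemigroup_induction with
  | one => exact Commute.one_right s
  | mul g t ih =>
    refine Commute.mul_right ?_ ih
    rw [Commute, SemiconjBy, mul_x, hs, conjLetter_one]

/-! ### Types -/

theorem type_one (O : Equipment G) : O.type 1 = 0 := by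
  simp [type]

theorem type_mul (O : Equipment G) (s t : O.FactSemigroup) :
    O.type (s * t) = O.type s + O.type t := by
  simp [type]

theorem type_pow (O : Equipment G) (s : O.FactSemigroup) (n : ℕ) :
    O.type (s ^ n) = n • O.type s := by
  simp [type]

open Classical in
theorem type_x (O : Equipment G) (g : O.carrier) :
    O.type (O.x g) = Pi.single (O.classOf g) 1 := by
  rfl

theorem type_x_apply (O : Equipment G) (g : O.carrier) (c : O.Classes)
    [Decidable (O.classOf g = c)] :
    O.type (O.x g) c = if O.classOf g = c then 1 else 0 := by
  classical
  rw [type_x, Pi.single_apply]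
  simp only [eq_comm]

theorem type_x_eq (O : Equipment G) {g h : O.carrier} (e : O.classOf g = O.classOf h) :
    O.type (O.x g) = O.type (O.x h) := by
  rw [type_x, type_x, e]

theorem one_le_type_x (O : Equipment G) (g : O.carrier) : 1 ≤ O.type (O.x g) (O.classOf g) := by
  simp [type_x]

theorem type_x_mul_eq (O : Equipment G) {g : O.carrier} {s t : O.FactSemigroup}
    (h : O.x g * s = t * O.x g) : O.type t = O.type s := by
  have := congrArg O.type h
  rw [type_mul, type_mul, add_comm] at this
  exact (add_right_cancel this).symm

open Classical in
/-- If `s` has more than `n * |G|` factors in the class `c`, then `n + 1` of them can be made equal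
and moved to the front. -/
theorem exists_x_pow_mul [Finite G] (O : Equipment G) (c : O.Classes) (n : ℕ)
    (s : O.FactSemigroup) (hs : n * Nat.card G < O.type s c) :
    ∃ g, O.classOf g = c ∧ ∃ t, s = O.x g ^ (n + 1) * t := by
  obtain ⟨w, rfl⟩ := PresentedMonoid.surjective_mk s
  have := Fintype.ofFinite G
  have key : O.type (PresentedMonoid.mk O.FactRel w) c =
      ∑ g : O.carrier, if O.classOf g = c then List.count g w.toList else 0 := by
    clear hs
    induction w using FreeMonoid.inductionOn' with
    | one => simp [type_one]
    | of_mul h w ih =>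
      rw [map_mul, type_mul, Pi.add_apply, ih]
      change O.type (O.x h) c + _ = _
      rw [type_x_apply, FreeMonoid.toList_mul, FreeMonoid.toList_of]
      simp only [List.singleton_append, List.count_cons, beq_iff_eq]
      have : ∀ g : O.carrier, (if O.classOf g = c then
          List.count g w.toList + (if h = g then 1 else 0) else 0) =
          (if O.classOf g = c then List.count g w.toList else 0) +
          (if h = g then (if O.classOf h = c then 1 else 0) else 0) := by
        intro g
        by_cases e : h = g
        · subst e; split_ifs <;> simp
        · simp [e]
      simp only [this, Finset.sum_add_distrib, Finset.sum_ite_eq, Finset.mem_univ, if_true]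
      rw [add_comm]
  -- There are at most `|G|` letters, so if each one in the class occurred at most `n` times the
  -- total would not exceed `n * |G|`.
  have pigeon : ∃ g, O.classOf g = c ∧ n + 1 ≤ List.count g w.toList := by
    by_contra! hcon
    rw [key] at hs
    refine absurd hs (not_lt.2 ?_)
    calc _ ≤ ∑ g : O.carrier, n := by
            refine Finset.sum_le_sum fun g _ => ?_
            split_ifs with hg
            · exact Nat.lt_succ_iff.1 (hcon g hg)
            · exact Nat.zero_le _
      _ = Nat.card O.carrier * n := by simp [Finset.sum_const, Nat.card_eq_fintype_card]
      _ ≤ n * Nat.card G := by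
        rw [mul_comm]
        exact Nat.mul_le_mul_left _ (Finite.card_subtype_le _)
  obtain ⟨g, hg, hcount⟩ := pigeon
  refine ⟨g, hg, ?_⟩
  clear hs key
  generalize n + 1 = k at hcount
  induction w using FreeMonoid.inductionOn' generalizing k with
  | one => obtain rfl : k = 0 := by simpa using hcount
           exact ⟨1, by simp⟩
  | of_mul h w ih =>
    rw [FreeMonoid.toList_mul, FreeMonoid.toList_of, List.singleton_append, List.count_cons]
      at hcount
    rw [map_mul]
    change ∃ t, O.x h * _ = _
    by_cases e : h = g
    · subst e
      cases k with
      | zero => exact ⟨_, (one_mul _).symm⟩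
      | succ k =>
        obtain ⟨t, ht⟩ := ih k (by simpa using hcount)
        exact ⟨t, by rw [ht, pow_succ', mul_assoc]⟩
    · obtain ⟨t, ht⟩ := ih k (by simpa only [beq_iff_eq, e, if_false, add_zero] using hcount)
      obtain ⟨u, hu⟩ := O.exists_x_mul_pow_eq g h k
      exact ⟨u * t, by rw [ht, ← mul_assoc, hu, mul_assoc]⟩

theorem exists_x_mul [Finite G] (O : Equipment G) (c : O.Classes)
    (s : O.FactSemigroup) (hs : 0 < O.type s c) :
    ∃ g, O.classOf g = c ∧ ∃ t, s = O.x g * t := by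
  simpa using O.exists_x_pow_mul c 0 s (by simpa using hs)

theorem eq_one_of_type_eq_zero (O : Equipment G) {s : O.FactSemigroup} (hs : O.type s = 0) :
    s = 1 := by
  induction s using factSemigroup_induction with
  | one => rfl
  | mul g s _ =>
    have h := congrFun hs (O.classOf g)
    have := O.one_le_type_x g
    rw [type_mul, Pi.add_apply, Pi.zero_apply] at h
    omega

/-! ### The subgroup generated by the factors -/

theorem factorSubgroup_mul (O : Equipment G) (s t : O.FactSemigroup) :
    O.factorSubgroup (s * t) = O.factorSubgroup s ⊔ O.factorSubgroup t := by
  induction s, t using PresentedMonoid.inductionOn₂ with | _ v w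
  rw [← map_mul, factorSubgroup_mk, factorSubgroup_mk, factorSubgroup_mk, wordSubgroup_mul]

theorem factorSubgroup_x (O : Equipment G) (g : O.carrier) :
    O.factorSubgroup (O.x g) = Subgroup.closure {(g : G)} :=
  O.wordSubgroup_of g

theorem fullElements_mul_left (O : Equipment G) {s t : O.FactSemigroup}
    (ht : t ∈ O.fullElements) : s * t ∈ O.fullElements := by
  change _ = _
  rw [factorSubgroup_mul, show O.factorSubgroup t = ⊤ from ht, sup_top_eq]

theorem fullElements_mul_right (O : Equipment G) {s t : O.FactSemigroup}
    (hs : s ∈ O.fullElements) : s * t ∈ O.fullElements := by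
  change _ = _
  rw [factorSubgroup_mul, show O.factorSubgroup s = ⊤ from hs, top_sup_eq]

theorem factorSubgroup_x_pow_le (O : Equipment G) (g : O.carrier) (n : ℕ) :
    O.factorSubgroup (O.x g ^ n) ≤ O.factorSubgroup (O.x g) := by
  induction n with
  | zero =>
    rw [pow_zero, ← map_one (PresentedMonoid.mk O.FactRel), factorSubgroup_mk, wordSubgroup]
    simp
  | succ n ih => rw [pow_succ, factorSubgroup_mul]; exact sup_le ih le_rfl

/-- A single copy of a repeated letter already contributes its whole subgroup, so the other copies
can be removed without losing fullness. -/
theorem x_mul_mem_fullElements (O : Equipment G) {g : O.carrier} {n : ℕ} {t : O.FactSemigroup}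
    (h : O.x g ^ n * t ∈ O.fullElements) : O.x g * t ∈ O.fullElements := by
  change _ = _ at h
  change _ = _
  rw [factorSubgroup_mul] at h ⊢
  exact top_le_iff.1 (h ▸ sup_le_sup_right (O.factorSubgroup_x_pow_le g n) _)

/-! ### Central powers of the generators -/

/-- The power `x_g ^ |G|`, whose product is trivial. -/
noncomputable def centralPow (O : Equipment G) (g : O.carrier) : O.FactSemigroup :=
  O.x g ^ Nat.card G

theorem prodHom_centralPow (O : Equipment G) (g : O.carrier) :
    O.prodHom (O.centralPow g) = 1 := by
  simp [centralPow]

/-- Carrying `x_h` across the power conjugates each letter by `h`, whereas centrality carries it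
across unchanged; the two results agree. -/
theorem centralPow_mul_x (O : Equipment G) (g h : O.carrier) :
    O.centralPow g * O.x h = O.centralPow (O.conjLetter (h : G) g) * O.x h := by
  have : O.x h * O.centralPow g = O.centralPow (O.conjLetter (h : G) g) * O.x h := by
    rw [centralPow, centralPow]
    induction Nat.card G with
    | zero => simp
    | succ n ih => rw [pow_succ, ← mul_assoc, ih, mul_assoc, x_mul_x, pow_succ, mul_assoc]
  rw [← this, (O.commute_of_prodHom_eq_one (O.prodHom_centralPow g) _).eq]

/-- The stabilizer-type subgroup of elements whose conjugation does not change
`x_g ^ |G| * s`. -/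
def centralPowSubgroup (O : Equipment G) (s : O.FactSemigroup) : Subgroup G where
  carrier := {a | ∀ g, O.centralPow (O.conjLetter a g) * s = O.centralPow g * s}
  one_mem' g := by rw [conjLetter_one]
  mul_mem' ha hb g := by rw [conjLetter_mul, ha, hb]
  inv_mem' {a} ha g := by rw [← ha (O.conjLetter a⁻¹ g), conjLetter_inv_self]

theorem factorSubgroup_le_centralPowSubgroup (O : Equipment G) (s : O.FactSemigroup) :
    O.factorSubgroup s ≤ O.centralPowSubgroup s := by
  induction s using factSemigroup_induction with
  | one =>
    rw [← map_one (PresentedMonoid.mk O.FactRel), factorSubgroup_mk, wordSubgroup]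
    simp
  | mul h s ih =>
    rw [factorSubgroup_mul, factorSubgroup_x]
    refine sup_le ?_ ?_
    · rw [Subgroup.closure_le, Set.singleton_subset_iff]
      intro g
      rw [← mul_assoc, ← mul_assoc, centralPow_mul_x O g]
    · intro a ha g
      rw [← mul_assoc, ← mul_assoc,
        (O.commute_of_prodHom_eq_one (O.prodHom_centralPow _) (O.x h)).eq,
        (O.commute_of_prodHom_eq_one (O.prodHom_centralPow _) (O.x h)).eq, mul_assoc, mul_assoc,
        ih ha g]

theorem centralPow_mul_eq (O : Equipment G) {s : O.FactSemigroup} (hs : s ∈ O.fullElements)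
    {g h : O.carrier} (e : O.classOf g = O.classOf h) :
    O.centralPow g * s = O.centralPow h * s := by
  obtain ⟨a, rfl⟩ := O.exists_conjLetter_of_classOf_eq e
  have ha : a ∈ O.centralPowSubgroup s :=
    O.factorSubgroup_le_centralPowSubgroup s (by rw [show O.factorSubgroup s = ⊤ from hs]; trivial)
  exact (ha g).symm

theorem exists_centralPow_mul [Finite G] (O : Equipment G) {s : O.FactSemigroup}
    (hs : s ∈ O.fullElements) (g : O.carrier)
    (h : Nat.card G * Nat.card G < O.type s (O.classOf g)) :
    ∃ t ∈ O.fullElements, s = O.centralPow g * t := by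
  -- The pigeonhole gives `|G| + 1` copies of `x_k`: `|G|` form the central power, and the spare one
  -- keeps the remainder full, which allows `k` to be replaced by its conjugate `g`.
  obtain ⟨k, hk, t, rfl⟩ := O.exists_x_pow_mul _ _ s h
  have ht := O.x_mul_mem_fullElements hs
  refine ⟨O.x k * t, ht, ?_⟩
  rw [← O.centralPow_mul_eq ht hk, pow_succ, mul_assoc, centralPow]

theorem exists_list_prod_mul [Finite G] (O : Equipment G) (l : List O.carrier)
    {s : O.FactSemigroup} (hs : s ∈ O.fullElements)
    (h : ∀ g ∈ l, Nat.card G * Nat.card G + l.length * Nat.card G < O.type s (O.classOf g)) :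
    ∃ t ∈ O.fullElements, s = (l.map O.centralPow).prod * t := by
  induction l generalizing s with
  | nil => exact ⟨s, hs, by simp⟩
  | cons g l ih =>
    obtain ⟨t, ht, rfl⟩ := O.exists_centralPow_mul hs g
      ((Nat.le_add_right _ _).trans_lt (h g (by simp)))
    obtain ⟨u, hu, rfl⟩ := ih ht fun k hk => by
      have := h k (by simp [hk])
      -- Each extracted power costs at most `|G|` letters in any class; this accounts for the
      -- summand `l.length * |G|` in the hypothesis.
      have hle : O.type (O.centralPow g) (O.classOf k) ≤ Nat.card G := by
        classical
        rw [centralPow, type_pow, Pi.smul_apply, type_x_apply, smul_eq_mul]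
        split_ifs <;> simp
      rw [type_mul, Pi.add_apply, List.length_cons, add_mul, one_mul] at this
      omega
    exact ⟨u, hu, by simp [mul_assoc]⟩

/-! ### The central element `U` -/

/-- A list of all letters. -/
noncomputable def letters [Finite G] (O : Equipment G) : List O.carrier :=
  (@Finset.univ _ (Fintype.ofFinite O.carrier)).toList

theorem mem_letters [Finite G] (O : Equipment G) (g : O.carrier) : g ∈ O.letters := by
  simp [letters]

/-- The product of the central powers of all generators. -/
noncomputable def totalPow [Finite G] (O : Equipment G) : O.FactSemigroup :=
  (O.letters.map O.centralPow).prod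

theorem prodHom_totalPow [Finite G] (O : Equipment G) : O.prodHom O.totalPow = 1 := by
  rw [totalPow, map_list_prod, List.map_map]
  refine List.prod_eq_one fun a ha => ?_
  obtain ⟨g, -, rfl⟩ := List.mem_map.1 ha
  exact O.prodHom_centralPow g

theorem commute_totalPow [Finite G] (O : Equipment G) (s : O.FactSemigroup) :
    Commute O.totalPow s :=
  O.commute_of_prodHom_eq_one O.prodHom_totalPow s

theorem exists_totalPow_eq [Finite G] (O : Equipment G) (g : O.carrier) :
    ∃ t, O.totalPow = t * O.x g := by
  obtain ⟨l₁, l₂, h⟩ := List.append_of_mem (O.mem_letters g)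
  refine ⟨(l₁.map O.centralPow).prod * (l₂.map O.centralPow).prod * O.x g ^ (Nat.card G - 1), ?_⟩
  have e : O.x g ^ (Nat.card G - 1) * O.x g = O.centralPow g := by
    rw [← pow_succ, Nat.sub_add_cancel Nat.card_pos, centralPow]
  rw [totalPow, h, mul_assoc, e, List.map_append, List.prod_append, List.map_cons,
    List.prod_cons, (O.commute_of_prodHom_eq_one (O.prodHom_centralPow g) _).eq, mul_assoc]

theorem totalPow_mem_fullElements [Finite G] (O : Equipment G)
    (hgen : Subgroup.closure O.carrier = ⊤) : O.totalPow ∈ O.fullElements := by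
  refine top_le_iff.1 (hgen ▸ (Subgroup.closure_le _).2 fun g hg => ?_)
  obtain ⟨t, ht⟩ := O.exists_totalPow_eq ⟨g, hg⟩
  rw [ht, factorSubgroup_mul, factorSubgroup_x]
  exact Subgroup.mem_sup_right (Subgroup.subset_closure rfl)

theorem exists_classOf_eq (O : Equipment G) (c : O.Classes) : ∃ g, O.classOf g = c := by
  obtain ⟨a, ha⟩ := c.1.exists_rep
  exact ⟨⟨a, c.2 (ConjClasses.mem_carrier_iff_mk_eq.2 ha)⟩, Subtype.ext ha⟩

theorem one_le_type_totalPow [Finite G] (O : Equipment G) (c : O.Classes) :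
    1 ≤ O.type O.totalPow c := by
  obtain ⟨g, rfl⟩ := O.exists_classOf_eq c
  obtain ⟨t, ht⟩ := O.exists_totalPow_eq g
  rw [ht, type_mul, Pi.add_apply]
  exact (O.one_le_type_x g).trans (Nat.le_add_left _ _)

/-! ### Sub-equipments -/

section Inclusion

variable {O O' : Equipment G} (hsub : O'.carrier ⊆ O.carrier)

/-- The homomorphism `S(G, O') → S(G, O)` for `O' ⊆ O`. -/
def inclHom : O'.FactSemigroup →* O.FactSemigroup :=
  PresentedMonoid.lift (fun g : O'.carrier => O.x ⟨g, hsub g.2⟩) (by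
    rintro _ _ (⟨g₁, g₂⟩ | ⟨g₁, g₂⟩)
    · exact PresentedMonoid.mk_eq_mk_of_rel (FactRel.right (O := O) ⟨g₁, hsub g₁.2⟩ ⟨g₂, hsub g₂.2⟩)
    · exact PresentedMonoid.mk_eq_mk_of_rel (FactRel.left (O := O) ⟨g₁, hsub g₁.2⟩ ⟨g₂, hsub g₂.2⟩))

@[simp]
theorem inclHom_x (g : O'.carrier) : inclHom hsub (O'.x g) = O.x ⟨g, hsub g.2⟩ := rfl

theorem prodHom_inclHom (s : O'.FactSemigroup) :
    O.prodHom (inclHom hsub s) = O'.prodHom s := by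
  induction s using factSemigroup_induction with
  | one => simp
  | mul g s ih => simp [ih]

theorem exists_inclHom_totalPow_pow_mul [Finite G] (M : ℕ) {s : O.FactSemigroup}
    (hs : s ∈ O.fullElements)
    (h : ∀ c : O.Classes, c.1.carrier ⊆ O'.carrier →
      Nat.card G * Nat.card G + M * O'.letters.length * Nat.card G < O.type s c) :
    ∃ t ∈ O.fullElements, s = inclHom hsub O'.totalPow ^ M * t := by
  let L : List O.carrier := O'.letters.map fun g : O'.carrier => ⟨g, hsub g.2⟩
  have hL : ((List.replicate M L).flatten.map O.centralPow).prod =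
      inclHom hsub O'.totalPow ^ M := by
    rw [List.map_flatten, List.map_replicate, List.prod_flatten, List.map_replicate,
      List.prod_replicate, totalPow, map_list_prod, List.map_map, List.map_map]
    congr 3
    funext g
    simp [centralPow]
  rw [← hL]
  refine O.exists_list_prod_mul _ hs fun g hg => ?_
  have hlen : (List.replicate M L).flatten.length = M * O'.letters.length := by simp [L]
  rw [hlen]
  refine h _ fun a ha => ?_
  obtain ⟨l, hl, hg⟩ := List.mem_flatten.1 hg
  rw [List.eq_of_mem_replicate hl] at hg
  obtain ⟨k, -, rfl⟩ := List.mem_map.1 hg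
  exact (O'.classOf k).2 ha

end Inclusion

/-! ### The full elements of type `M • τ(U)` -/

/-- The elements of `S(G, O)^G` of the same type as `U ^ M`. -/
def stratum [Finite G] (O : Equipment G) (M : ℕ) : Set O.FactSemigroup :=
  {u ∈ O.fullElements | O.type u = M • O.type O.totalPow}

theorem exists_totalPow_mul_of_mem_stratum [Finite G] (O : Equipment G) {M : ℕ}
    (hM : Nat.card G * Nat.card G + O.letters.length * Nat.card G < M + 1) {u : O.FactSemigroup}
    (hu : u ∈ O.stratum (M + 1)) : ∃ t ∈ O.stratum M, u = O.totalPow * t := by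
  obtain ⟨t, ht, rfl⟩ := exists_inclHom_totalPow_pow_mul (O' := O) Set.Subset.rfl 1 hu.1
    fun c _ => by
      rw [hu.2, one_mul, Pi.smul_apply, smul_eq_mul]
      exact hM.trans_le (Nat.le_mul_of_pos_right _ (O.one_le_type_totalPow c))
  have hid : inclHom (Set.Subset.refl O.carrier) = MonoidHom.id _ := by
    ext g; rfl
  rw [hid, pow_one, MonoidHom.id_apply] at hu ⊢
  refine ⟨t, ⟨ht, ?_⟩, rfl⟩
  have := hu.2
  rw [type_mul, succ_nsmul, add_comm] at this
  exact add_right_cancel this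

section Inclusion

variable {O O' : Equipment G} (hsub : O'.carrier ⊆ O.carrier)

theorem exists_inclHom_mul_x [Finite G] (hgen : Subgroup.closure O'.carrier = ⊤) {M : ℕ}
    (hM : Nat.card G * Nat.card G + O'.letters.length * Nat.card G < M + 1) (a : G)
    (h : O.carrier) {u : O'.FactSemigroup} (hu : u ∈ O'.stratum (M + 1)) :
    ∃ v ∈ O'.stratum (M + 1), inclHom hsub u * O.x h = inclHom hsub v * O.x (O.conjLetter a h) := by
  have ha : a ∈ Submonoid.closure O'.carrier := by
    -- In a finite group no inverses are needed, so conjugation by elements of `O'` suffices.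
    rw [← Subgroup.closure_toSubmonoid_of_finite, hgen]; trivial
  induction ha using Submonoid.closure_induction generalizing h u with
  | one => exact ⟨u, hu, by rw [conjLetter_one]⟩
  | mul a b _ _ iha ihb =>
    obtain ⟨v, hv, e⟩ := ihb h hu
    obtain ⟨w, hw, e'⟩ := iha (O.conjLetter b h) hv
    exact ⟨w, hw, by rw [e, e', conjLetter_mul]⟩
  | mem g hg =>
    obtain ⟨v, hv, rfl⟩ := O'.exists_totalPow_mul_of_mem_stratum hM hu
    obtain ⟨t, ht⟩ := O'.exists_totalPow_eq ⟨g, hg⟩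
    -- With `U = t * x_g` and `k = g h g⁻¹`, two exchanges give `x_g x_h = x_k x_g = x_{g'} x_k`.
    -- The letter `g'` is conjugate to `g`, so the type is preserved; fullness comes from `v`.
    let g' : O'.carrier := O'.conjLetter (O.conjLetter g h) ⟨g, hg⟩
    refine ⟨v * (t * O'.x g'), ⟨O'.fullElements_mul_right hv.1, ?_⟩, ?_⟩
    · rw [← hu.2, ht, type_mul, type_mul, type_mul, type_mul, add_comm,
        O'.type_x_eq (O'.classOf_conjLetter _ ⟨g, hg⟩)]
    · rw [(O'.commute_totalPow v).eq, ht]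
      simp only [map_mul, inclHom_x, mul_assoc]
      rw [x_mul_x, x_mul_x]
      rfl

/-- Multiplying by full elements with many factors in `O'` makes all elements of a given type
equivalent. -/
theorem exists_inclHom_mul [Finite G] (hgen : Subgroup.closure O'.carrier = ⊤) {M : ℕ}
    (hM : Nat.card G * Nat.card G + O'.letters.length * Nat.card G < M + 1)
    (s₀ s : O.FactSemigroup) (hs : O.type s = O.type s₀) {u : O'.FactSemigroup}
    (hu : u ∈ O'.stratum (M + 1)) :
    ∃ v ∈ O'.stratum (M + 1), inclHom hsub u * s = inclHom hsub v * s₀ := by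
  induction s₀ using factSemigroup_induction_right generalizing s u with
  | one =>
    obtain rfl := O.eq_one_of_type_eq_zero (hs.trans O.type_one)
    exact ⟨u, hu, rfl⟩
  | mul h s₀ ih =>
    obtain ⟨k, hk, t, rfl⟩ := O.exists_x_mul (O.classOf h) s (by
      rw [hs, type_mul, Pi.add_apply]
      exact Nat.add_pos_right _ (O.one_le_type_x h))
    obtain ⟨a, rfl⟩ := O.exists_conjLetter_of_classOf_eq hk
    -- The leading letter is conjugated into the last letter `h` of the target, then moved to the
    -- right end, after which the induction hypothesis treats what remains.
    obtain ⟨v, hv, e⟩ := exists_inclHom_mul_x hsub hgen hM a k hu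
    obtain ⟨t', ht'⟩ := O.exists_x_mul_eq (O.conjLetter a k) t
    obtain ⟨w, hw, e'⟩ := ih t' (by
      rw [type_mul, type_mul, add_comm, ← O.type_x_eq hk] at hs
      rw [O.type_x_mul_eq ht']
      exact add_right_cancel hs) hv
    exact ⟨w, hw, by rw [← mul_assoc, e, mul_assoc, ht', ← mul_assoc, e', mul_assoc]⟩

end Inclusion

/-! ### Cancellation -/

theorem finite_setOf_type_eq [Finite G] (O : Equipment G) (f : O.Classes → ℕ) :
    {s : O.FactSemigroup | O.type s = f}.Finite := by
  have := Fintype.ofFinite O.Classes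
  have := Fintype.ofFinite O.carrier
  refine ((List.finite_length_eq O.carrier (∑ c, f c)).image
    fun l => PresentedMonoid.mk O.FactRel (FreeMonoid.ofList l)).subset ?_
  rintro s rfl
  obtain ⟨w, rfl⟩ := PresentedMonoid.surjective_mk s
  refine ⟨w.toList, ?_, rfl⟩
  induction w using FreeMonoid.inductionOn' with
  | one => simp [type_one]
  | of_mul g w ih =>
    classical
    rw [map_mul, type_mul]
    change _ = ∑ c, (O.type (O.x g) + _) c
    simp only [Pi.add_apply, Finset.sum_add_distrib, type_x_apply]
    simp only [Set.mem_ofPred_eq] at ih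
    rw [← ih]
    simp [add_comm]

theorem totalPow_mul_mem_stratum [Finite G] (O : Equipment G) {M : ℕ} {u : O.FactSemigroup}
    (hu : u ∈ O.stratum M) (k : ℕ) : O.totalPow ^ k * u ∈ O.stratum (M + k) :=
  ⟨O.fullElements_mul_left hu.1, by rw [type_mul, type_pow, hu.2, add_smul, add_comm]⟩

theorem image_totalPow_pow_mul_stratum [Finite G] (O : Equipment G) {M : ℕ}
    (hM : Nat.card G * Nat.card G + O.letters.length * Nat.card G < M + 1) (k : ℕ) :
    (O.totalPow ^ k * ·) '' O.stratum M = O.stratum (M + k) := by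
  refine Set.Subset.antisymm ?_ ?_
  · rintro _ ⟨u, hu, rfl⟩
    exact O.totalPow_mul_mem_stratum hu k
  · induction k with
    | zero => simp
    | succ k ih =>
      intro u hu
      obtain ⟨t, ht, rfl⟩ := O.exists_totalPow_mul_of_mem_stratum (M := M + k) (by omega) hu
      obtain ⟨v, hv, rfl⟩ := ih ht
      exact ⟨v, hv, by simp only [pow_succ', mul_assoc]⟩

/-- Beyond the threshold, multiplication by `U ^ k` is onto the later stratum. Starting from a
stratum of least cardinality, a surjection between finite sets with no smaller target is injective.
-/
theorem exists_injOn_totalPow_pow_mul [Finite G] (O : Equipment G) (B : ℕ) :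
    ∃ M ≥ B, ∀ k, Set.InjOn (O.totalPow ^ k * ·) (O.stratum M) := by
  let B' := B + (Nat.card G * Nat.card G + O.letters.length * Nat.card G)
  obtain ⟨j, hj⟩ : ∃ j, ∀ i, (O.stratum (B' + j)).ncard ≤ (O.stratum (B' + i)).ncard :=
    ⟨Function.argmin fun i => (O.stratum (B' + i)).ncard,
      fun i => Function.argmin_le (fun i => (O.stratum (B' + i)).ncard) i⟩
  refine ⟨B' + j, by omega, fun k => ?_⟩
  have hfin : (O.stratum (B' + j)).Finite :=
    (O.finite_setOf_type_eq _).subset fun u hu => hu.2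
  refine Set.injOn_of_ncard_image_eq (le_antisymm (Set.ncard_image_le hfin) ?_) hfin
  have h := hj (j + k)
  rwa [← add_assoc, ← O.image_totalPow_pow_mul_stratum (M := B' + j) (by omega) k] at h

/-! ### The map to the `C`-group -/

theorem of_conj_eq (O : Equipment G) {g₁ g₂ g : O.carrier} (h : (g : G)⁻¹ * g₁ * g = g₂) :
    (PresentedGroup.of g : O.CGroup)⁻¹ * PresentedGroup.of g₁ * PresentedGroup.of g =
      PresentedGroup.of g₂ := by
  have : PresentedGroup.mk O.cRels ((FreeGroup.of g)⁻¹ * FreeGroup.of g₁ * FreeGroup.of g *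
      (FreeGroup.of g₂)⁻¹) = 1 :=
    PresentedGroup.one_of_mem ⟨g₁, g₂, g, h, rfl⟩
  rw [map_mul, map_inv, mul_inv_eq_one, map_mul, map_mul, map_inv] at this
  exact this

/-- The natural homomorphism from the factorization semigroup to the `C`-group. -/
def toCGroup (O : Equipment G) : O.FactSemigroup →* O.CGroup :=
  PresentedMonoid.lift (fun g : O.carrier => PresentedGroup.of g) (by
    rintro _ _ (⟨g₁, g₂⟩ | ⟨g₁, g₂⟩)
    · simp only [map_mul, FreeMonoid.lift_eval_of]
      have := O.of_conj_eq (g₁ := g₁) (g := g₂) (g₂ := ⟨_, O.inv_conj_mem g₁.2 g₂⟩) rfl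
      rw [← this]
      group
    · simp only [map_mul, FreeMonoid.lift_eval_of]
      rw [← O.of_conj_eq (g₁ := O.conjLetter g₁ g₂) (g := g₁) (g₂ := g₂) (by simp [mul_assoc]),
        ← mul_assoc, mul_inv_cancel_left]
      rfl)

@[simp]
theorem toCGroup_x (O : Equipment G) (g : O.carrier) :
    O.toCGroup (O.x g) = PresentedGroup.of g := rfl

theorem beta_of (O : Equipment G) (g : O.carrier) : O.beta (PresentedGroup.of g) = g :=
  PresentedGroup.toGroup.of _

theorem beta_toCGroup (O : Equipment G) (s : O.FactSemigroup) :
    O.beta (O.toCGroup s) = O.prodHom s := by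
  induction s using factSemigroup_induction with
  | one => simp
  | mul g s ih => rw [map_mul, map_mul, map_mul, ih, toCGroup_x, beta_of, prodHom_x]

/-- The `C`-group acts on its generators through `G`. -/
theorem mul_of_mul_inv (O : Equipment G) (z : O.CGroup) (g : O.carrier) :
    z * PresentedGroup.of g * z⁻¹ = PresentedGroup.of (O.conjLetter (O.beta z) g) := by
  have hz : z ∈ Subgroup.closure (Set.range (PresentedGroup.of (rels := O.cRels))) := by
    rw [PresentedGroup.closure_range_of]; trivial
  induction hz using Subgroup.closure_induction generalizing g with
  | one => simp [conjLetter_one]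
  | mem _ h =>
    obtain ⟨h, rfl⟩ := h
    rw [← O.of_conj_eq (g₁ := O.conjLetter (O.beta (PresentedGroup.of h)) g) (g := h) (g₂ := g)
      (by simp [beta_of, mul_assoc])]
    group
  | mul a b _ _ iha ihb =>
    rw [map_mul, conjLetter_mul, ← iha, ← ihb]
    group
  | inv a _ iha =>
    rw [← O.conjLetter_inv_self (O.beta a) g, ← iha, map_inv, ← conjLetter_mul, ← conjLetter_mul]
    simp [mul_assoc]

theorem ker_beta_le_center (O : Equipment G) :
    O.beta.ker ≤ Subgroup.center O.CGroup := by
  intro z hz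
  have h : Subgroup.closure (Set.range (PresentedGroup.of (rels := O.cRels))) ≤
      Subgroup.centralizer {z} := by
    rw [Subgroup.closure_le]
    rintro _ ⟨g, rfl⟩
    have := O.mul_of_mul_inv z g
    rw [MonoidHom.mem_ker.1 hz, conjLetter_one, mul_inv_eq_iff_eq_mul] at this
    exact Subgroup.mem_centralizer_singleton_iff.2 this.symm
  rw [PresentedGroup.closure_range_of] at h
  exact Subgroup.mem_center_iff.2 fun a =>
    Subgroup.mem_centralizer_singleton_iff.1 (h (Subgroup.mem_top a))

open scoped commutatorElement in
/-- A group with a homomorphism to a finite group whose kernel is central has finite commutator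
subgroup. -/
theorem finite_commutator_of_ker_le_center {H : Type*} [Group H] [Finite G] (f : H →* G)
    (hf : f.ker ≤ Subgroup.center H) : Finite (commutator H) := by
  -- Every element is a chosen preimage of its image times a central element, so a commutator
  -- depends only on the two images in `G`.
  have hs : ∀ a : H, ∃ z ∈ Subgroup.center H, a = Function.invFun f (f a) * z := fun a =>
    ⟨(Function.invFun f (f a))⁻¹ * a, hf (by
      rw [MonoidHom.mem_ker, map_mul, map_inv, Function.invFun_eq (f := f) ⟨a, rfl⟩, inv_mul_cancel]),
      by simp⟩
  have : Finite (commutatorSet H) := by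
    refine Set.Finite.subset (Set.finite_range fun p : G × G =>
      ⁅Function.invFun f p.1, Function.invFun f p.2⁆) ?_
    rintro _ ⟨a, b, rfl⟩
    refine ⟨(f a, f b), ?_⟩
    obtain ⟨y, hy, ha⟩ := hs a
    obtain ⟨z, hz, hb⟩ := hs b
    dsimp only
    generalize Function.invFun f (f a) = a' at *
    generalize Function.invFun f (f b) = b' at *
    subst ha hb
    rw [Subgroup.mem_center_iff] at hy hz
    symm
    calc a' * y * (b' * z) * (a' * y)⁻¹ * (b' * z)⁻¹
        = a' * (y * (b' * z)) * y⁻¹ * a'⁻¹ * z⁻¹ * b'⁻¹ := by group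
      _ = a' * b' * (z * a'⁻¹) * z⁻¹ * b'⁻¹ := by rw [← hy]; group
      _ = a' * b' * a'⁻¹ * b'⁻¹ := by rw [← hz]; group
  -- Schur's theorem: finitely many commutators generate a finite subgroup.
  infer_instance

/-- Ensures that `ambiguityIndex` is a true cardinality and not the value `0` that `Nat.card` gives
to infinite types. -/
theorem finite_ker_beta_inf_commutator [Finite G] (O : Equipment G) :
    Finite (O.beta.ker ⊓ commutator O.CGroup : Subgroup O.CGroup) := by
  have := finite_commutator_of_ker_le_center O.beta O.ker_beta_le_center
  exact Finite.of_injective _ (Subgroup.inclusion_injective inf_le_right)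

/-- Since `O` generates `G`, `beta` is surjective, so a conjugation in `G` lifts to one in the
`C`-group and dies in the abelianization. -/
theorem abelianization_of_eq (O : Equipment G) (hgen : Subgroup.closure O.carrier = ⊤)
    {g h : O.carrier} (e : O.classOf g = O.classOf h) :
    Abelianization.of (PresentedGroup.of g : O.CGroup) =
      Abelianization.of (PresentedGroup.of h : O.CGroup) := by
  obtain ⟨a, rfl⟩ := O.exists_conjLetter_of_classOf_eq e
  have ha : a ∈ O.beta.range := by
    have : Subgroup.closure O.carrier ≤ O.beta.range :=
      (Subgroup.closure_le _).2 fun g hg => ⟨_, O.beta_of ⟨g, hg⟩⟩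
    exact this (hgen ▸ Subgroup.mem_top a)
  obtain ⟨z, rfl⟩ := ha
  rw [← mul_of_mul_inv, map_mul, map_mul, map_inv, mul_inv_cancel_comm]

theorem abelianization_toCGroup_eq [Finite G] (O : Equipment G)
    (hgen : Subgroup.closure O.carrier = ⊤) {s t : O.FactSemigroup} (h : O.type s = O.type t) :
    Abelianization.of (O.toCGroup s) = Abelianization.of (O.toCGroup t) := by
  have := Fintype.ofFinite O.Classes
  choose r hr using O.exists_classOf_eq
  have key : ∀ s : O.FactSemigroup, Abelianization.of (O.toCGroup s) =
      ∏ c, Abelianization.of (PresentedGroup.of (r c) : O.CGroup) ^ O.type s c := by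
    classical
    intro s
    induction s using factSemigroup_induction with
    | one => simp [type_one]
    | mul g s ih =>
      simp only [map_mul, ih, type_mul, Pi.add_apply, pow_add, Finset.prod_mul_distrib,
        type_x_apply, pow_ite, pow_one, pow_zero, Finset.prod_ite_eq, Finset.mem_univ, if_true,
        toCGroup_x]
      rw [O.abelianization_of_eq hgen (hr (O.classOf g))]
  rw [key, key, h]

/-! ### Localization at `U` -/

noncomputable instance oreSetPowersTotalPow [Finite G] (O : Equipment G) :
    OreLocalization.OreSet (Submonoid.powers O.totalPow) where
  ore_right_cancel r₁ r₂ s h := by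
    obtain ⟨_, k, rfl⟩ := s
    have hc := fun r => ((O.commute_totalPow r).pow_left k).eq
    exact ⟨⟨_, k, rfl⟩, by simpa only [hc] using h⟩
  oreNum r _ := r
  oreDenom _ s := s
  ore_eq r s := by
    obtain ⟨_, k, rfl⟩ := s
    exact ((O.commute_totalPow r).pow_left k).eq

/-- The localization of the factorization semigroup at the powers of `U`. -/
abbrev Loc [Finite G] (O : Equipment G) : Type _ :=
  OreLocalization (Submonoid.powers O.totalPow) O.FactSemigroup

/-- The natural homomorphism to the localization. -/
noncomputable abbrev toLoc [Finite G] (O : Equipment G) : O.FactSemigroup →* O.Loc :=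
  OreLocalization.numeratorHom

/-- `U = t * x_g` becomes invertible, and the two factors commute because `t` has product `g⁻¹`,
which fixes `g` under conjugation. -/
theorem isUnit_toLoc_x [Finite G] (O : Equipment G) (g : O.carrier) : IsUnit (O.toLoc (O.x g)) := by
  obtain ⟨t, ht⟩ := O.exists_totalPow_eq g
  have hα : O.prodHom t = (g : G)⁻¹ := by
    have := O.prodHom_totalPow
    rw [ht, map_mul, prodHom_x] at this
    exact eq_inv_of_mul_eq_one_left this
  have hc : Commute t (O.x g) := by
    rw [Commute, SemiconjBy, mul_x, hα]
    congr 2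
    ext; simp
  have hu : IsUnit (O.toLoc t * O.toLoc (O.x g)) := by
    rw [← map_mul, ← ht]
    exact OreLocalization.numerator_isUnit ⟨O.totalPow, Submonoid.mem_powers _⟩
  exact ((hc.map O.toLoc).isUnit_mul_iff.1 hu).2

/-- The homomorphism from the `C`-group to the units of the localization. -/
noncomputable def cGroupToLoc [Finite G] (O : Equipment G) : O.CGroup →* O.Locˣ :=
  PresentedGroup.toGroup (rels := O.cRels) (f := fun g => (O.isUnit_toLoc_x g).unit) (by
    rintro _ ⟨g₁, g₂, g, h, rfl⟩
    simp only [map_mul, map_inv, FreeGroup.lift_apply_of]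
    rw [mul_inv_eq_one, mul_assoc, inv_mul_eq_iff_eq_mul]
    ext
    simp only [Units.val_mul, IsUnit.unit_spec, ← map_mul]
    rw [x_mul_x O g]
    congr 3
    ext
    simp [← h, mul_assoc])

theorem cGroupToLoc_toCGroup [Finite G] (O : Equipment G) (s : O.FactSemigroup) :
    (O.cGroupToLoc (O.toCGroup s) : O.Loc) = O.toLoc s := by
  induction s using factSemigroup_induction with
  | one => rw [map_one, map_one, map_one, Units.val_one]
  | mul g s ih =>
    rw [map_mul, map_mul, map_mul, Units.val_mul, ih, toCGroup_x, cGroupToLoc,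
      PresentedGroup.toGroup.of, IsUnit.unit_spec]

theorem exists_totalPow_pow_mul_eq [Finite G] (O : Equipment G) {s t : O.FactSemigroup}
    (h : O.toCGroup s = O.toCGroup t) : ∃ k, O.totalPow ^ k * s = O.totalPow ^ k * t := by
  have h' : O.toLoc s = O.toLoc t := by
    rw [← cGroupToLoc_toCGroup, h, cGroupToLoc_toCGroup]
  obtain ⟨⟨_, k, rfl⟩, v, h₁, h₂⟩ := OreLocalization.oreDiv_eq_iff.1 h'
  refine ⟨k, ?_⟩
  simp only [Submonoid.coe_one, mul_one] at h₂
  rw [← h₂] at h₁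
  exact h₁.symm

/-! ### The main estimate -/

theorem encard_stratum_prodHom_eq_one_le [Finite G] (O : Equipment G)
    (hgen : Subgroup.closure O.carrier = ⊤) {M : ℕ}
    (hM : ∀ k, Set.InjOn (O.totalPow ^ k * ·) (O.stratum M)) :
    {u ∈ O.stratum M | O.prodHom u = 1}.encard ≤ (O.ambiguityIndex : ℕ∞) := by
  have hfin := O.finite_ker_beta_inf_commutator
  rw [ambiguityIndex, ← SetLike.coe_sort_coe, Nat.card_coe_set_eq, Set.Finite.cast_ncard_eq hfin]
  refine Set.encard_le_encard_of_injOn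
    (f := fun u => O.toCGroup u * (O.toCGroup (O.totalPow ^ M))⁻¹) ?_ ?_
  -- Trivial product places the image in `ker β`; having the type of `U ^ M` places it in the
  -- commutator subgroup.
  · rintro u ⟨hu, hα⟩
    refine ⟨?_, ?_⟩
    · change O.beta _ = 1
      rw [map_mul, map_inv, beta_toCGroup, beta_toCGroup, hα, map_pow, prodHom_totalPow]
      simp
    · change _ ∈ commutator O.CGroup
      rw [← Abelianization.ker_of, MonoidHom.mem_ker, map_mul, map_inv,
        mul_inv_eq_one]
      exact O.abelianization_toCGroup_eq hgen (hu.2.trans (O.type_pow _ _).symm)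
  · rintro u ⟨hu, -⟩ v ⟨hv, -⟩ h
    obtain ⟨k, hk⟩ := O.exists_totalPow_pow_mul_eq (mul_right_cancel h)
    exact hM k hu hv hk

end Equipment

theorem mainTheorem3 {G : Type*} [Group G] [Finite G] (O O' : Equipment G)
    (hsub : O'.carrier ⊆ O.carrier) (hgen : Subgroup.closure O'.carrier = ⊤) :
    ∃ T : ℕ, ∀ s₁ ∈ O.fullElements,
      (∀ c : O.Classes, c.1.carrier ⊆ O'.carrier → T ≤ O.type s₁ c) →
      {s ∈ O.fullElements | O.type s = O.type s₁ ∧ O.prodHom s = O.prodHom s₁}.encard ≤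
        (O'.ambiguityIndex : ℕ∞) := by
  obtain ⟨M, hMB, hM⟩ := O'.exists_injOn_totalPow_pow_mul
    (Nat.card G * Nat.card G + O'.letters.length * Nat.card G + 1)
  -- The exchange step consumes one factor `U`; the `+ 1` in the bound above yields both this
  -- predecessor and the strict inequality `exists_inclHom_mul` needs.
  obtain ⟨M, rfl⟩ : ∃ M', M = M' + 1 := ⟨M - 1, by omega⟩
  refine ⟨Nat.card G * Nat.card G + (M + 1) * O'.letters.length * Nat.card G + 1,
    fun s₁ hs₁ hT => ?_⟩
  refine le_trans ?_ (O'.encard_stratum_prodHom_eq_one_le hgen hM)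
  obtain ⟨t₁, ht₁, rfl⟩ := Equipment.exists_inclHom_totalPow_pow_mul hsub (M + 1) hs₁
    fun c hc => hT c hc
  -- Every competitor `s` is of the form `u * t₁` with `t₁` fixed, so the set is an image of the set
  -- of admissible `u`.
  refine (Set.encard_le_encard ?_).trans
    (Set.encard_image_le (fun u => Equipment.inclHom hsub u * t₁) _)
  rintro s ⟨hs, hτ, hα⟩
  obtain ⟨t, ht, rfl⟩ := Equipment.exists_inclHom_totalPow_pow_mul hsub (M + 1) hs
    fun c hc => hτ ▸ hT c hc
  rw [O.type_mul, O.type_mul] at hτ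
  obtain ⟨u, hu, e⟩ := Equipment.exists_inclHom_mul hsub hgen (M := M) (by omega) t₁ t
    (add_left_cancel hτ) (u := O'.totalPow ^ (M + 1))
    ⟨by rw [pow_succ]; exact O'.fullElements_mul_left (O'.totalPow_mem_fullElements hgen),
      O'.type_pow _ _⟩
  rw [map_pow] at e
  refine ⟨u, ⟨hu, ?_⟩, e.symm⟩
  rw [e, map_mul, map_mul, map_pow, Equipment.prodHom_inclHom, Equipment.prodHom_inclHom,
    O'.prodHom_totalPow, one_pow] at hα
  exact mul_right_cancel hα
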